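/- Let $G$ be a projective profinite group, that is, for every continuous epimorphism $\alpha\colon A\to B$ of profinite groups and every continuous homomorphism $f\colon G\to B$ there is a continuous homomorphism $g\colon G\to A$ with $\alpha\circ g=f$. Let $K$ be a closed subgroup of $G$ which is - (topologically) finitely generated, - prosupersolvable, that is, an inverse limit of finite supersolvable groups (finite groups all of whose chief factors are cyclic), and - of order divisible by only finitely many primes, where the order of $K$ is the supernatural number $\operatorname{lcm}\{[K:V] : V \text{ an open normal subgroup of } K\}$. Then $K$ is virtually a retract of $G$: there exist an open subgroup $U$ of $G$ containing $K$ and a closed normal subgroup $N$ of $U$ such that $KN=U$ and $K\cap N=\{1\}$. -/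

import Mathlib

universe u

/-- `H / N` is a chief factor of the group `S`: both `N < H` are normal in `S`, and no normal
subgroup of `S` lies strictly between them. -/
structure IsChiefFactor {S : Type u} [Group S] (N H : Subgroup S) : Prop where
  normal_left : N.Normal
  normal_right : H.Normal
  lt : N < H
  eq_or_eq : ∀ M : Subgroup S, M.Normal → N ≤ M → M ≤ H → M = N ∨ M = H

/-- Supersolvability of a (finite) group: all chief factors are cyclic. -/
def IsSupersolvable (S : Type u) [Group S] : Prop :=
  ∀ (N H : Subgroup S) [N.Normal], IsChiefFactor N H → IsCyclic (H ⧸ N.subgroupOf H)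

/-- A topological group is prosupersolvable if it is isomorphic, as a topological group, to the
inverse limit of an inverse system (over a directed set) of finite supersolvable groups, each with
the discrete topology. -/
def IsProsupersolvable (S : Type u) [Group S] [TopologicalSpace S] : Prop :=
  ∃ (I : Type u) (_ : Preorder I) (_ : IsDirectedOrder I) (_ : Nonempty I)
    (F : CategoryTheory.Functor Iᵒᵖ FiniteGrp.{u}),
    (∀ i, IsSupersolvable (F.obj i)) ∧
      Nonempty (S ≃ₜ* ProfiniteGrp.limit
        (F.comp (CategoryTheory.forget₂ FiniteGrp.{u} ProfiniteGrp.{u})))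

/-- Topological finite generation: some finite subset generates a dense subgroup. -/
def IsTopologicallyFinitelyGenerated (S : Type u) [Group S] [TopologicalSpace S] : Prop :=
  ∃ X : Finset S, Dense (Subgroup.closure (X : Set S) : Set S)

/-- The order of a profinite group `S`, as a supernatural number `∏ p ^ n(p)` with
`n(p) ∈ ℕ ∪ {∞}`: the least common multiple of the indices of the open normal subgroups of `S`.
It is given by its sequence of exponents `n(p)`. -/
noncomputable def profiniteOrder (S : Type u) [Group S] [TopologicalSpace S]
    (p : Nat.Primes) : ℕ∞ :=
  ⨆ U : OpenNormalSubgroup S, ((padicValNat p (U : Subgroup S).index : ℕ) : ℕ∞)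

/-- A profinite group `G` is projective if every embedding problem for it is weakly solvable: for
every continuous epimorphism `α : A → B` of profinite groups and every continuous homomorphism
`f : G → B` there is a continuous homomorphism `g : G → A` with `α ∘ g = f`. -/
def IsProjectiveProfinite (G : Type u) [Group G] [TopologicalSpace G] : Prop :=
  ∀ (A B : ProfiniteGrp.{u}) (α : A →ₜ* B) (f : G →ₜ* B), Function.Surjective α →
    ∃ g : G →ₜ* A, α.comp g = f

/-- The closed subgroup `K` is a retract of the closed subgroup `U` (of a profinite group `G`):
`K ≤ U` and there is a closed normal subgroup `N` of `U` with `KN = U` and `K ∩ N = {1}`. -/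
def IsRetractOf {G : Type u} [Group G] [TopologicalSpace G] (K U : Subgroup G) : Prop :=
  K ≤ U ∧ ∃ N : Subgroup G, IsClosed (N : Set G) ∧ N ≤ U ∧ (N.subgroupOf U).Normal ∧
    {x : G | ∃ k ∈ K, ∃ n ∈ N, k * n = x} = (U : Set G) ∧ K ⊓ N = ⊥

open Topology

/-! Maximal open subgroups of `K` have prime index, as in finite supersolvable groups. Only finitely
many primes divide the order of `K`, and finite generation allows finitely many open subgroups of
each index, so the Frattini subgroup of `K` is open. It contains an open normal `V`, and a closed
`H` with `HV = K` is all of `K`.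

The projection `K → K/V` extends to an open subgroup `U ⊇ K`. Since `U` is again projective, the
extension lifts to `g : U → K`. On `K`, `g` is the identity modulo `V`, hence surjective by the
Frattini property and injective because `K` is Hopfian. So `N = ker g` is the required complement.
-/

/-! ### Maximal subgroups of supersolvable groups -/

theorem IsChiefFactor.prime_relIndex {S : Type u} [Group S] [Finite S] (hS : IsSupersolvable S)
    {N H : Subgroup S} (h : IsChiefFactor N H) : (N.relIndex H).Prime := by
  have := h.normal_left
  have := h.normal_right
  have hc : IsCyclic (H ⧸ N.subgroupOf H) := hS N H h
  have hne : N.relIndex H ≠ 1 := fun h1 ↦ h.lt.not_ge (Subgroup.relIndex_eq_one.mp h1)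
  obtain ⟨p, hp, hpd⟩ := Nat.exists_prime_and_dvd hne
  have hpow : ∀ x (hx : x ∈ H), x ^ p ∈ N ↔ ((⟨x, hx⟩ : H) : H ⧸ N.subgroupOf H) ^ p = 1 := by
    intro x hx
    rw [← QuotientGroup.mk_pow, QuotientGroup.eq_one_iff, Subgroup.mem_subgroupOf]
    simp
  -- `P/N` is the `p`-torsion of the abelian group `H/N`: normal, and nontrivial by Cauchy, so it is
  -- all of `H/N`. A cyclic group of exponent dividing `p` has order dividing `p`.
  let P : Subgroup S :=
    { carrier := {x | x ∈ H ∧ x ^ p ∈ N}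
      one_mem' := ⟨H.one_mem, by simp⟩
      mul_mem' := by
        rintro x y ⟨hx, hx'⟩ ⟨hy, hy'⟩
        refine ⟨H.mul_mem hx hy, ?_⟩
        let _ : CommGroup (H ⧸ N.subgroupOf H) := hc.commGroup
        rw [hpow _ (H.mul_mem hx hy)]
        rw [hpow _ hx] at hx'
        rw [hpow _ hy] at hy'
        have : ((⟨x * y, H.mul_mem hx hy⟩ : H) : H ⧸ N.subgroupOf H)
          = ((⟨x, hx⟩ : H) : H ⧸ N.subgroupOf H) * ((⟨y, hy⟩ : H) : H ⧸ N.subgroupOf H) := rfl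
        rw [this, mul_pow, hx', hy', one_mul]
      inv_mem' := by
        rintro x ⟨hx, hx'⟩
        exact ⟨H.inv_mem hx, by rw [inv_pow]; exact N.inv_mem hx'⟩ }
  have hPn : P.Normal := ⟨fun x hx g ↦
    ⟨h.normal_right.conj_mem x hx.1 g, by rw [conj_pow]; exact h.normal_left.conj_mem _ hx.2 g⟩⟩
  have hNP : N ≤ P := fun x hx ↦ ⟨h.lt.le hx, N.pow_mem hx p⟩
  have hPH : P ≤ H := fun x hx ↦ hx.1
  have := Fact.mk hp
  obtain ⟨q, hq⟩ := exists_prime_orderOf_dvd_card' (G := H ⧸ N.subgroupOf H) p hpd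
  obtain ⟨⟨x, hx⟩, rfl⟩ := QuotientGroup.mk_surjective q
  have hxP : x ∈ P := ⟨hx, (hpow x hx).mpr (by rw [← hq]; exact pow_orderOf_eq_one _)⟩
  have hxN : x ∉ N := fun hxN ↦ by
    have : ((⟨x, hx⟩ : H) : H ⧸ N.subgroupOf H) = 1 := by
      rwa [QuotientGroup.eq_one_iff, Subgroup.mem_subgroupOf]
    rw [this, orderOf_one] at hq
    exact hp.one_lt.ne hq
  have hP : P = H := (h.eq_or_eq P hPn hNP hPH).resolve_left fun e ↦ hxN (e ▸ hxP)
  have hexp : Monoid.exponent (H ⧸ N.subgroupOf H) ∣ p := by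
    rw [Monoid.exponent_dvd_iff_forall_pow_eq_one]
    intro q
    obtain ⟨⟨y, hy⟩, rfl⟩ := QuotientGroup.mk_surjective q
    exact (hpow y hy).mp (hP.ge hy).2
  rw [IsCyclic.exponent_eq_card] at hexp
  have : N.relIndex H = p := Nat.dvd_antisymm hexp hpd
  rwa [this]

/-- A normal `H`, minimal with preimage not inside `M`, lies over a chief factor `H/N`. The preimage
of `N` is inside `M` and that of `H` supplements `M`, so the index of `M` divides the prime `[H :
N]`. -/
theorem IsSupersolvable.prime_index_of_isCoatom {S : Type u} [Group S] [Finite S]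
    (hS : IsSupersolvable S) {T : Type*} [Group T] (φ : T →* S) {M : Subgroup T}
    (hM : IsCoatom M) (hφ : φ.ker ≤ M) : M.index.Prime := by
  classical
  obtain ⟨H, ⟨hHn, hHM⟩, hHmin⟩ := WellFounded.has_min (wellFounded_lt (α := Subgroup S))
    {H | H.Normal ∧ ¬ H.comap φ ≤ M} ⟨⊤, inferInstance, by
      rw [Subgroup.comap_top, top_le_iff]; exact hM.1⟩
  have hHbot : ⊥ < H := bot_lt_iff_ne_bot.mpr fun e ↦ hHM (by rwa [e])
  obtain ⟨N, ⟨hNn, hNH⟩, hNmax⟩ := WellFounded.has_min (wellFounded_gt (α := Subgroup S))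
    {N | N.Normal ∧ N < H} ⟨⊥, inferInstance, hHbot⟩
  have hchief : IsChiefFactor N H := ⟨hNn, hHn, hNH, fun L hL hNL hLH ↦ by
    by_contra! hne
    exact hNmax L ⟨hL, lt_of_le_of_ne hLH hne.2⟩ (lt_of_le_of_ne hNL hne.1.symm)⟩
  have hNM : N.comap φ ≤ M := by
    by_contra hN
    exact hHmin N ⟨hNn, hN⟩ hNH
  have hprime := hchief.prime_relIndex hS
  have hsup : M ⊔ H.comap φ = ⊤ := hM.2 _ (left_lt_sup.mpr hHM)
  have hidx : M.relIndex (H.comap φ) = M.index := by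
    have h1 := Subgroup.relIndex_inf_mul_relIndex M (H.comap φ) ⊤
    have h2 := Subgroup.relIndex_inf_mul_relIndex (H.comap φ) M ⊤
    rw [inf_comm (H.comap φ) M, ← h1] at h2
    have h3 : (H.comap φ).relIndex M = (H.comap φ).index := by
      rw [← Subgroup.relIndex_sup_right, hsup, Subgroup.relIndex_top_right]
    have h4 : (H.comap φ).index ≠ 0 := by
      rw [Subgroup.index_comap]
      exact fun h ↦ Subgroup.index_ne_zero_of_finite (Subgroup.index_eq_zero_of_relIndex_eq_zero h)
    simp only [inf_top_eq, Subgroup.relIndex_top_right, h3, mul_comm (H.comap φ).index] at h2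
    exact (Nat.eq_of_mul_eq_mul_right (Nat.pos_of_ne_zero h4) h2).symm
  have hdvd : M.index ∣ N.relIndex H := by
    rw [← hidx]
    refine (Subgroup.relIndex_dvd_of_le_left _ hNM).trans ?_
    -- `φ` need not be onto: only `H ∩ range φ` is seen, and normality of `N` gives divisibility.
    rw [Subgroup.relIndex_comap, Subgroup.map_comap_eq]
    rw [← Subgroup.relIndex_subgroupOf (inf_le_right)]
    exact Subgroup.relIndex_dvd_index_of_normal _ _
  exact ((Nat.dvd_prime hprime).mp hdvd).resolve_left
    (fun h1 ↦ hM.1 (Subgroup.index_eq_one.mp h1)) ▸ hprime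

/-! ### Open subgroups of finitely generated groups -/

/-- Numbering the cosets makes `M` a point stabiliser on `Fin n`. The permutations induced by `X`
and the base point determine `M ∩ ⟨X⟩`, which is dense in the open subgroup `M`. -/
theorem Subgroup.finite_setOf_isOpen_index_eq {K : Type*} [Group K] [TopologicalSpace K]
    [IsTopologicalGroup K] {X : Finset K} (hX : Dense (Subgroup.closure (X : Set K) : Set K))
    {n : ℕ} (hn : n ≠ 0) : {M : Subgroup K | IsOpen (M : Set K) ∧ M.index = n}.Finite := by
  classical
  have hfin (M : {M : Subgroup K | IsOpen (M : Set K) ∧ M.index = n}) :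
      Nonempty ((K ⧸ M.1) ≃ Fin n) := by
    have hc : Nat.card (K ⧸ M.1) = n := M.2.2
    have : Finite (K ⧸ M.1) := Nat.finite_of_card_ne_zero (hc.trans_ne hn)
    exact ⟨Finite.equivFinOfCardEq hc⟩
  let e M := (hfin M).some
  let F (M : {M : Subgroup K | IsOpen (M : Set K) ∧ M.index = n}) :
      (X → Equiv.Perm (Fin n)) × Fin n :=
    (fun x ↦ (e M).permCongr (MulAction.toPermHom K (K ⧸ M.1) x), e M (1 : K))
  have key (M M' : {M : Subgroup K | IsOpen (M : Set K) ∧ M.index = n}) (h : F M = F M') :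
      M.1 ≤ M'.1 := by
    have h1 : ∀ x ∈ Subgroup.closure (X : Set K), ∀ i,
        e M (x • (e M).symm i) = e M' (x • (e M').symm i) := by
      intro x hx
      induction hx using Subgroup.closure_induction with
      | mem x hx => intro i; exact congr($(congrFun (congrArg Prod.fst h) ⟨x, hx⟩) i)
      | one => simp
      | mul x y _ _ hx hy =>
        intro i
        have := hx (e M (y • (e M).symm i))
        rw [Equiv.symm_apply_apply, hy i, Equiv.symm_apply_apply] at this
        rw [mul_smul, mul_smul, this]
      | inv x _ hx =>
        intro i
        have := hx (e M (x⁻¹ • (e M).symm i))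
        rw [Equiv.symm_apply_apply, smul_inv_smul, Equiv.apply_symm_apply] at this
        rw [eq_comm, ← Equiv.eq_symm_apply, inv_smul_eq_iff, Equiv.symm_apply_eq]
        exact this
    have h2 : e M ((1 : K) : K ⧸ M.1) = e M' ((1 : K) : K ⧸ M'.1) := congrArg Prod.snd h
    have h3 : ∀ x ∈ Subgroup.closure (X : Set K), x ∈ M.1 → x ∈ M'.1 := by
      intro x hx hxM
      have h4 := h1 x hx (e M ((1 : K) : K ⧸ M.1))
      rw [Equiv.symm_apply_apply, h2, Equiv.symm_apply_apply] at h4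
      have h5 (L : Subgroup K) : x • ((1 : K) : K ⧸ L) = ((1 : K) : K ⧸ L) ↔ x ∈ L := by
        change ((x * 1 : K) : K ⧸ L) = _ ↔ _
        rw [eq_comm, QuotientGroup.eq]
        simp
      rw [(h5 M.1).mpr hxM, h2] at h4
      exact (h5 M'.1).mp ((e M').injective h4.symm)
    intro x hx
    have h6 := hX.open_subset_closure_inter M.2.1 hx
    have h7 : IsClosed (M'.1 : Set K) := M'.1.isClosed_of_isOpen M'.2.1
    exact closure_minimal (fun y hy ↦ h3 y hy.2 hy.1) h7 h6
  have : Finite {M : Subgroup K | IsOpen (M : Set K) ∧ M.index = n} :=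
    Finite.of_injective F fun M M' h ↦ Subtype.ext (le_antisymm (key M M' h) (key M' M h.symm))
  exact Set.toFinite _

/-- Topologically finitely generated profinite groups are Hopfian. -/
theorem IsTopologicallyFinitelyGenerated.injective_of_surjective {K : Type*} [Group K]
    [TopologicalSpace K] [IsTopologicalGroup K] [CompactSpace K] [TotallyDisconnectedSpace K]
    (hK : IsTopologicallyFinitelyGenerated K) (g : K →ₜ* K) (hg : Function.Surjective g) :
    Function.Injective g := by
  obtain ⟨X, hX⟩ := hK
  rw [injective_iff_map_eq_one]
  intro k hk
  by_contra hk1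
  obtain ⟨V, hV⟩ := ProfiniteGrp.exist_openNormalSubgroup_sub_open_nhds_of_one
    (isOpen_compl_singleton (x := k)) (Ne.symm hk1)
  have hn : V.toSubgroup.index ≠ 0 := by
    have := V.toSubgroup.quotient_finite_of_isOpen V.isOpen'
    exact Subgroup.index_ne_zero_of_finite
  have hfin := Subgroup.finite_setOf_isOpen_index_eq hX hn
  -- Pullback along `g` is an injective self-map of a finite set, so `V` is itself a pullback and
  -- contains `ker g`.
  have hmaps : Set.MapsTo (fun M : Subgroup K ↦ M.comap (g : K →* K))
      {M | IsOpen (M : Set K) ∧ M.index = V.toSubgroup.index}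
      {M | IsOpen (M : Set K) ∧ M.index = V.toSubgroup.index} := fun M hM ↦
    ⟨hM.1.preimage g.continuous_toFun,
      (Subgroup.index_comap_of_surjective (f := (g : K →* K)) M hg).trans hM.2⟩
  have := hfin.to_subtype
  have hinj : Function.Injective hmaps.restrict := fun M M' h ↦
    Subtype.ext (Subgroup.comap_injective (f := (g : K →* K)) hg (congrArg Subtype.val h))
  obtain ⟨M, hM⟩ := Finite.surjective_of_injective hinj ⟨V.toSubgroup, V.isOpen', rfl⟩
  replace hM : M.1.comap (g : K →* K) = V.toSubgroup := congrArg Subtype.val hM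
  have : k ∈ V.toSubgroup := by
    rw [← hM]
    change g k ∈ M.1
    rw [hk]; exact M.1.one_mem
  exact hV this rfl

/-- The permutational wreath product of `A` by the symmetric group of `X`. -/
def PermWreath (A X : Type*) : Type _ := (X → A) × Equiv.Perm X

/-! ### Wreath products and projectivity of open subgroups -/

namespace PermWreath

section Group

variable {A X : Type*} [Group A]

instance : Group (PermWreath A X) where
  mul a b := (fun x ↦ a.1 x * b.1 (a.2⁻¹ x), a.2 * b.2)
  one := (1, 1)
  inv a := (fun x ↦ (a.1 (a.2 x))⁻¹, a.2⁻¹)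
  mul_assoc a b c := Prod.ext (funext fun x ↦ by
    change a.1 x * b.1 (a.2⁻¹ x) * c.1 ((a.2 * b.2)⁻¹ x) =
      a.1 x * (b.1 (a.2⁻¹ x) * c.1 (b.2⁻¹ (a.2⁻¹ x)))
    rw [mul_inv_rev, Equiv.Perm.mul_apply, mul_assoc]) (mul_assoc a.2 b.2 c.2)
  one_mul a := Prod.ext (funext fun x ↦ by
    change 1 * a.1 ((1 : Equiv.Perm X)⁻¹ x) = a.1 x
    simp) (one_mul a.2)
  mul_one a := Prod.ext (funext fun x ↦ mul_one (a.1 x)) (mul_one a.2)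
  inv_mul_cancel a := Prod.ext (funext fun x ↦ by
    change (a.1 (a.2 x))⁻¹ * a.1 (a.2⁻¹⁻¹ x) = 1
    simp) (inv_mul_cancel a.2)

theorem fst_mul (a b : PermWreath A X) (x : X) : (a * b).1 x = a.1 x * b.1 (a.2⁻¹ x) := rfl

theorem fst_one (x : X) : (1 : PermWreath A X).1 x = 1 := rfl

end Group

section Topology

variable {A X : Type*} [TopologicalSpace A]

/-- The product topology, for the discrete topology on permutations. -/
instance : TopologicalSpace (PermWreath A X) :=
  @instTopologicalSpaceProd (X → A) (Equiv.Perm X) _ ⊥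

theorem continuous_fst : Continuous fun a : PermWreath A X ↦ a.1 :=
  letI : TopologicalSpace (Equiv.Perm X) := ⊥
  _root_.continuous_fst

theorem continuous_snd : Continuous[_, ⊥] fun a : PermWreath A X ↦ a.2 :=
  letI : TopologicalSpace (Equiv.Perm X) := ⊥
  _root_.continuous_snd

theorem continuous_mk {Y : Type*} [TopologicalSpace Y] {f : Y → X → A} {σ : Y → Equiv.Perm X}
    (hf : ∀ x, Continuous fun y ↦ f y x) (hσ : Continuous[_, ⊥] σ) :
    Continuous fun y ↦ show PermWreath A X from (f y, σ y) :=
  @Continuous.prodMk (X → A) (Equiv.Perm X) Y _ ⊥ _ f σ (continuous_pi hf) hσ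

theorem continuous_fst_apply {Y : Type*} [TopologicalSpace Y] {f : Y → PermWreath A X}
    (hf : Continuous f) {x : Y → X} (hx : ∀ y, ∀ᶠ z in 𝓝 y, x z = x y) :
    Continuous fun y ↦ (f y).1 (x y) := by
  rw [continuous_iff_continuousAt]
  intro y
  have : Continuous fun z ↦ (f z).1 (x y) :=
    (continuous_apply (x y)).comp (continuous_fst.comp hf)
  exact this.continuousAt.congr ((hx y).mono fun z hz ↦ by simp only [hz])

theorem eventually_snd_eq {Y : Type*} [TopologicalSpace Y] {f : Y → PermWreath A X}
    (hf : Continuous f) (y : Y) : ∀ᶠ z in 𝓝 y, (f z).2 = (f y).2 := by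
  let : TopologicalSpace (Equiv.Perm X) := ⊥
  have : DiscreteTopology (Equiv.Perm X) := ⟨rfl⟩
  have h : Continuous fun z ↦ (f z).2 := continuous_snd.comp hf
  exact h.continuousAt.eventually_mem (isOpen_discrete {(f y).2} |>.mem_nhds rfl)

theorem continuous_snd_comp {Y Z : Type*} [TopologicalSpace Y] {f : Y → PermWreath A X}
    (hf : Continuous f) (F : Equiv.Perm X → Z) : Continuous[_, ⊥] fun y ↦ F (f y).2 := by
  let : TopologicalSpace (Equiv.Perm X) := ⊥
  let : TopologicalSpace Z := ⊥
  have : DiscreteTopology (Equiv.Perm X) := ⟨rfl⟩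
  have h : Continuous fun z ↦ (f z).2 := continuous_snd.comp hf
  exact (continuous_of_discreteTopology (f := F)).comp h

instance [Group A] [IsTopologicalGroup A] : IsTopologicalGroup (PermWreath A X) where
  continuous_mul := continuous_mk
    (fun x ↦ ((continuous_apply x).comp (continuous_fst.comp _root_.continuous_fst)).mul
      (continuous_fst_apply (x := fun p : PermWreath A X × PermWreath A X ↦ p.1.2⁻¹ x)
        _root_.continuous_snd fun y ↦
          (eventually_snd_eq _root_.continuous_fst y).mono fun z hz ↦ by rw [hz]))
    (by
      let : TopologicalSpace (Equiv.Perm X) := ⊥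
      have : DiscreteTopology (Equiv.Perm X) := ⟨rfl⟩
      have h : Continuous fun a : PermWreath A X ↦ a.2 := continuous_snd
      exact (h.comp _root_.continuous_fst).mul (h.comp _root_.continuous_snd))
  continuous_inv := continuous_mk
    (fun x ↦ (continuous_fst_apply (x := fun a : PermWreath A X ↦ a.2 x) continuous_id fun y ↦
        (eventually_snd_eq continuous_id y).mono fun z hz ↦ congr($hz x)).inv)
    (continuous_snd_comp continuous_id fun σ ↦ σ⁻¹)

instance [CompactSpace A] [Finite X] : CompactSpace (PermWreath A X) :=
  letI : TopologicalSpace (Equiv.Perm X) := ⊥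
  inferInstanceAs (CompactSpace ((X → A) × Equiv.Perm X))

instance [TotallyDisconnectedSpace A] : TotallyDisconnectedSpace (PermWreath A X) :=
  letI : TopologicalSpace (Equiv.Perm X) := ⊥
  haveI : DiscreteTopology (Equiv.Perm X) := ⟨rfl⟩
  inferInstanceAs (TotallyDisconnectedSpace ((X → A) × Equiv.Perm X))

end Topology

section Map

variable {A B X : Type*} [Group A] [Group B] [TopologicalSpace A] [TopologicalSpace B]

/-- The homomorphism of permutational wreath products induced by a homomorphism. -/
def map (α : A →ₜ* B) : PermWreath A X →ₜ* PermWreath B X where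
  toFun a := (fun x ↦ α (a.1 x), a.2)
  map_one' := Prod.ext (funext fun _ ↦ map_one α) rfl
  map_mul' a b := Prod.ext (funext fun x ↦ map_mul α (a.1 x) (b.1 (a.2⁻¹ x))) rfl
  continuous_toFun := continuous_mk
    (fun x ↦ α.continuous_toFun.comp ((continuous_apply x).comp continuous_fst)) continuous_snd

theorem map_surjective {α : A →ₜ* B} (hα : Function.Surjective α) :
    Function.Surjective (map (X := X) α) := fun b ↦ by
  choose s hs using hα
  exact ⟨(fun x ↦ s (b.1 x), b.2), Prod.ext (funext fun x ↦ hs _) rfl⟩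

end Map

end PermWreath

/-- Open subgroups of projective profinite groups are projective. -/
theorem IsProjectiveProfinite.of_isOpen {G : Type u} [Group G] [TopologicalSpace G]
    [IsTopologicalGroup G] [CompactSpace G] (hG : IsProjectiveProfinite G) {U : Subgroup G}
    (hU : IsOpen (U : Set G)) : IsProjectiveProfinite U := by
  classical
  intro A B α f hα
  have : Finite (G ⧸ U) := U.quotient_finite_of_isOpen hU
  have : DiscreteTopology (G ⧸ U) := QuotientGroup.discreteTopology hU
  -- Normalising `s` at the base coset makes the base coordinate of `β u` below equal to `f u` for
  -- `u ∈ U`.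
  obtain ⟨s, hs, hs1⟩ : ∃ s : G ⧸ U → G, (∀ q, (s q : G ⧸ U) = q) ∧ s (1 : G) = 1 := by
    refine ⟨Function.update Quotient.out ((1 : G) : G ⧸ U) 1, fun q ↦ ?_, by simp⟩
    by_cases hq : q = ((1 : G) : G ⧸ U)
    · simp [hq]
    · rw [Function.update_of_ne hq]; exact Quotient.out_eq q
  have hmem (g : G) (q : G ⧸ U) : (s q)⁻¹ * (g * s (g⁻¹ • q)) ∈ U := by
    rw [← QuotientGroup.eq, hs]
    change q = g • ((s (g⁻¹ • q) : G) : G ⧸ U)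
    rw [hs, smul_inv_smul]
  have hperm : Continuous[_, ⊥] fun g : G ↦ MulAction.toPermHom G (G ⧸ U) g := by
    let : TopologicalSpace (Equiv.Perm (G ⧸ U)) := ⊥
    have : DiscreteTopology (Equiv.Perm (G ⧸ U)) := ⟨rfl⟩
    have : U.FiniteIndex := U.finiteIndex_of_finite_quotient
    refine continuous_of_continuousAt_one (MulAction.toPermHom G (G ⧸ U)) ?_
    rw [ContinuousAt, map_one, nhds_discrete (Equiv.Perm (G ⧸ U)), Filter.tendsto_pure]
    have hopen : IsOpen (U.normalCore : Set G) :=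
      Subgroup.isOpen_of_isClosed_of_finiteIndex _
        (U.normalCore_isClosed (U.isClosed_of_isOpen hU))
    filter_upwards [hopen.mem_nhds U.normalCore.one_mem] with g hg
    rw [Subgroup.normalCore_eq_ker] at hg
    exact hg
  -- `β` is the homomorphism induced from `f`, which turns a problem for `U` into one for `G`.
  let β : G →ₜ* PermWreath B (G ⧸ U) :=
    { toFun := fun g ↦ (fun q ↦ f ⟨_, hmem g q⟩, MulAction.toPermHom G (G ⧸ U) g)
      map_one' := Prod.ext (funext fun q ↦ by
        change f _ = 1
        rw [← map_one f]
        congr 1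
        ext
        simp) (map_one _)
      map_mul' := fun g h ↦ Prod.ext (funext fun q ↦ by
        change f _ = f _ * f ⟨_, hmem h (g⁻¹ • q)⟩
        rw [← map_mul f]
        congr 1
        ext
        simp [mul_assoc, mul_smul]) (map_mul _ g h)
      continuous_toFun := PermWreath.continuous_mk (fun q ↦ by
        refine f.continuous_toFun.comp (Continuous.subtype_mk
          (f := fun g ↦ (s q)⁻¹ * (g * s (g⁻¹ • q))) ?_ fun g ↦ hmem g q)
        refine continuous_const.mul (continuous_id.mul ?_)
        exact (continuous_of_discreteTopology (f := s)).comp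
          (QuotientGroup.continuous_mk.comp (continuous_inv.mul continuous_const) |>.congr
            fun g ↦ show ((g⁻¹ * s q : G) : G ⧸ U) = g⁻¹ • q by
              conv_rhs => rw [← hs q]
              rfl)) hperm }
  obtain ⟨γ, hγ⟩ := hG (ProfiniteGrp.of (PermWreath A (G ⧸ U)))
    (ProfiniteGrp.of (PermWreath B (G ⧸ U))) (PermWreath.map α) β (PermWreath.map_surjective hα)
  have hγβ (g : G) : PermWreath.map α (γ g) = β g := DFunLike.congr_fun hγ g
  -- Elements of `U` fix the base coset, so the base coordinate of `γ` is multiplicative on `U`.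
  have hfix (u : U) : ((γ u : PermWreath A (G ⧸ U)).2)⁻¹ ((1 : G) : G ⧸ U) = (1 : G) := by
    have h : (γ u : PermWreath A (G ⧸ U)).2 = MulAction.toPermHom G (G ⧸ U) u :=
      congrArg Prod.snd (hγβ u)
    rw [h, Equiv.Perm.inv_eq_iff_eq]
    change ((1 : G) : G ⧸ U) = ((u * 1 : G) : G ⧸ U)
    rw [QuotientGroup.eq]
    simp
  refine ⟨{ toFun := fun u ↦ (γ u : PermWreath A (G ⧸ U)).1 (1 : G)
            map_one' := by
              rw [OneMemClass.coe_one, map_one]; exact PermWreath.fst_one _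
            map_mul' := fun u v ↦ by
              have := PermWreath.fst_mul (γ u : PermWreath A (G ⧸ U)) (γ v) ((1 : G) : G ⧸ U)
              rw [hfix] at this
              rw [Subgroup.coe_mul, map_mul]
              exact this
            continuous_toFun := (continuous_apply ((1 : G) : G ⧸ U)).comp
              (PermWreath.continuous_fst.comp (γ.continuous_toFun.comp continuous_subtype_val)) }, ?_⟩
  ext u
  have h := congrFun (congrArg Prod.fst (hγβ u)) ((1 : G) : G ⧸ U)
  refine h.trans ?_
  change f _ = f u
  congr 1
  ext
  have hu : (u : G)⁻¹ • ((1 : G) : G ⧸ U) = ((1 : G) : G ⧸ U) := by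
    change (((u : G)⁻¹ * 1 : G) : G ⧸ U) = _
    rw [QuotientGroup.eq]
    simp
  simp [hu, hs1]

/-! ### Openness of the Frattini subgroup -/

/-- The kernels of the projections are closed, directed and meet trivially; compactness puts one
inside `W`. -/
theorem IsProsupersolvable.exists_ker_le {K : Type u} [Group K] [TopologicalSpace K]
    (hK : IsProsupersolvable K) {W : Set K} (hW : IsOpen W) (h1 : 1 ∈ W) :
    ∃ (S : FiniteGrp.{u}) (φ : K →* S), IsSupersolvable S ∧ (φ.ker : Set K) ⊆ W := by
  obtain ⟨I, _, _, _, F, hF, ⟨e⟩⟩ := hK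
  let D := F.comp (CategoryTheory.forget₂ FiniteGrp.{u} ProfiniteGrp.{u})
  let π (i : I) : K →* F.obj (.op i) :=
    { toFun := fun k ↦ (e k).val (.op i)
      map_one' := by rw [map_one]; rfl
      map_mul' := fun x y ↦ by rw [map_mul]; rfl }
  have hmono {i j : I} (hij : i ≤ j) : (π j).ker ≤ (π i).ker := fun x hx ↦ by
    have h := (e x).2 (CategoryTheory.homOfLE hij).op
    have hx' : (e x).val (.op j) = 1 := hx
    rw [hx', map_one] at h
    exact h.symm
  have hclosed (i : I) : IsClosed ((π i).ker : Set K) := by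
    have : Continuous fun k ↦ (e k).val (.op i) :=
      (continuous_apply _).comp (continuous_subtype_val.comp e.continuous)
    exact (isClosed_singleton (x := (1 : D.obj (.op i)))).preimage this
  have hcompact : CompactSpace K := e.symm.toHomeomorph.compactSpace
  obtain ⟨i, hi⟩ := exists_subset_nhds_of_compactSpace (V := fun i ↦ ((π i).ker : Set K))
    (fun i j ↦ by
      obtain ⟨k, hik, hjk⟩ := exists_ge_ge i j
      exact ⟨k, hmono hik, hmono hjk⟩) hclosed (U := W) (fun x hx ↦ by
        have : x = 1 := e.injective (ProfiniteGrp.limit_ext _ _ _ fun j ↦ by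
          rw [map_one]
          exact Set.mem_iInter.mp hx j.unop)
        rw [this]
        exact hW.mem_nhds h1)
  exact ⟨F.obj (.op i), π i, hF _, hi⟩

/-- `H` is an intersection of open subgroups; a proper open one above `H` of least index is maximal.
-/
theorem exists_isCoatom_isOpen_of_isClosed {K : Type*} [Group K] [TopologicalSpace K]
    [IsTopologicalGroup K] [CompactSpace K] [TotallyDisconnectedSpace K] {H : Subgroup K}
    (hH : IsClosed (H : Set K)) (hne : H ≠ ⊤) :
    ∃ M : Subgroup K, IsCoatom M ∧ IsOpen (M : Set K) ∧ H ≤ M := by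
  have hex : ∃ M : Subgroup K, IsOpen (M : Set K) ∧ H ≤ M ∧ M ≠ ⊤ := by
    by_contra! hall
    apply hne
    have := ProfiniteGrp.closedSubgroup_eq_sInf_open ⟨H, hH⟩
    change H = _ at this
    rw [this, sInf_eq_top]
    exact fun M hM ↦ hall M hM.1 hM.2
  obtain ⟨M, ⟨hMo, hHM, hMt⟩, hmin⟩ := WellFounded.has_min
    (measure (Subgroup.index (G := K))).wf {M | IsOpen (M : Set K) ∧ H ≤ M ∧ M ≠ ⊤} hex
  have := M.quotient_finite_of_isOpen hMo
  have : M.FiniteIndex := M.finiteIndex_of_finite_quotient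
  refine ⟨M, ⟨hMt, fun L hL ↦ ?_⟩, hMo, hHM⟩
  by_contra hLt
  exact hmin L ⟨Subgroup.isOpen_mono hL.le hMo, hHM.trans hL.le, hLt⟩ (Subgroup.index_strictAnti hL)

section Frattini

variable {K : Type u} [Group K] [TopologicalSpace K] [IsTopologicalGroup K] [CompactSpace K]
  [TotallyDisconnectedSpace K]

theorem profiniteOrder_ne_zero {M : Subgroup K} (hM : IsOpen (M : Set K)) (p : Nat.Primes)
    (hp : (p : ℕ) ∣ M.index) : profiniteOrder K p ≠ 0 := by
  obtain ⟨V, hV⟩ := ProfiniteGrp.exist_openNormalSubgroup_sub_open_nhds_of_one hM M.one_mem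
  have := V.toSubgroup.quotient_finite_of_isOpen V.isOpen'
  have hdvd : (p : ℕ) ∣ V.toSubgroup.index := hp.trans (Subgroup.index_dvd_of_le hV)
  have := Fact.mk p.2
  have h1 := one_le_padicValNat_of_dvd Subgroup.index_ne_zero_of_finite hdvd
  have h2 : ((padicValNat p V.toSubgroup.index : ℕ) : ℕ∞) ≤ profiniteOrder K p :=
    le_iSup (fun U : OpenNormalSubgroup K ↦
      ((padicValNat p (U : Subgroup K).index : ℕ) : ℕ∞)) V
  intro h
  rw [h, nonpos_iff_eq_zero, Nat.cast_eq_zero] at h2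
  omega

theorem IsProsupersolvable.finite_setOf_isCoatom (hfg : IsTopologicallyFinitelyGenerated K)
    (hss : IsProsupersolvable K) (hprimes : {p : Nat.Primes | profiniteOrder K p ≠ 0}.Finite) :
    {M : Subgroup K | IsCoatom M ∧ IsOpen (M : Set K)}.Finite := by
  obtain ⟨X, hX⟩ := hfg
  refine (hprimes.biUnion fun p _ ↦
    Subgroup.finite_setOf_isOpen_index_eq hX p.2.ne_zero).subset ?_
  rintro M ⟨hM, hMo⟩
  obtain ⟨S, φ, hS, hφ⟩ := hss.exists_ker_le hMo M.one_mem
  have hp := hS.prime_index_of_isCoatom φ hM hφ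
  exact Set.mem_biUnion (x := ⟨M.index, hp⟩) (profiniteOrder_ne_zero hMo ⟨M.index, hp⟩ dvd_rfl)
    ⟨hMo, rfl⟩

/-- The Frattini subgroup is open. -/
theorem IsProsupersolvable.exists_openNormalSubgroup_frattini
    (hfg : IsTopologicallyFinitelyGenerated K) (hss : IsProsupersolvable K)
    (hprimes : {p : Nat.Primes | profiniteOrder K p ≠ 0}.Finite) :
    ∃ V : OpenNormalSubgroup K, ∀ H : Subgroup K, IsClosed (H : Set K) →
      H ⊔ V.toSubgroup = ⊤ → H = ⊤ := by
  have hfin := hss.finite_setOf_isCoatom hfg hprimes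
  obtain ⟨V, hV⟩ := ProfiniteGrp.exist_openNormalSubgroup_sub_open_nhds_of_one
    (U := ⋂ M ∈ {M : Subgroup K | IsCoatom M ∧ IsOpen (M : Set K)}, (M : Set K))
    (hfin.isOpen_biInter fun M hM ↦ hM.2) (Set.mem_iInter₂.mpr fun M _ ↦ M.one_mem)
  refine ⟨V, fun H hH hHV ↦ ?_⟩
  by_contra hne
  obtain ⟨M, hM, hMo, hHM⟩ := exists_isCoatom_isOpen_of_isClosed hH hne
  exact hM.1 (top_le_iff.mp (hHV.ge.trans (sup_le hHM fun x hx ↦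
    Set.mem_iInter₂.mp (hV hx) M ⟨hM, hMo⟩)))

end Frattini

/-! ### Extension to an open subgroup and the retraction -/

/-- For an open normal `M` of `G` with `K ∩ M ⊆ V`, the map `km ↦ kV` is well defined on `KM`. -/
theorem exists_continuousMonoidHom_extending {G : Type u} [Group G] [TopologicalSpace G]
    [IsTopologicalGroup G] [CompactSpace G] [TotallyDisconnectedSpace G] (K : Subgroup G)
    (V : OpenNormalSubgroup K) :
    ∃ (U : Subgroup G) (hKU : K ≤ U) (f : U →ₜ* K ⧸ V.toSubgroup), IsOpen (U : Set G) ∧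
      ∀ k : K, f (Subgroup.inclusion hKU k) = (k : K ⧸ V.toSubgroup) := by
  obtain ⟨W, hW, hWV⟩ := isOpen_induced_iff.mp V.isOpen'
  obtain ⟨M, hM⟩ := ProfiniteGrp.exist_openNormalSubgroup_sub_open_nhds_of_one hW
    (show (1 : G) ∈ W from hWV.ge V.one_mem)
  have hMV (k : K) (hk : (k : G) ∈ M.toSubgroup) : k ∈ V.toSubgroup := hWV.le (hM hk)
  have hdec (u : (K ⊔ M.toSubgroup : Subgroup G)) : ∃ k : K, (k : G)⁻¹ * u ∈ M.toSubgroup := by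
    obtain ⟨k, hk, m, hm, h⟩ := Subgroup.mem_sup_of_normal_right.mp u.2
    exact ⟨⟨k, hk⟩, by rw [← h]; simpa using hm⟩
  choose r hr using hdec
  have hr' (u : (K ⊔ M.toSubgroup : Subgroup G)) (k : K) (h : (k : G)⁻¹ * u ∈ M.toSubgroup) :
      (r u : K ⧸ V.toSubgroup) = k := by
    rw [QuotientGroup.eq]
    apply hMV
    have := M.toSubgroup.mul_mem (hr u) (M.toSubgroup.inv_mem h)
    simpa using this
  let f : (K ⊔ M.toSubgroup : Subgroup G) →* K ⧸ V.toSubgroup :=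
    { toFun := fun u ↦ r u
      map_one' := hr' 1 1 (by simp)
      map_mul' := fun u v ↦ hr' (u * v) (r u * r v) (by
        have h1 := M.isNormal'.conj_mem _ (hr u) (r v : G)⁻¹
        have := M.toSubgroup.mul_mem h1 (hr v)
        simpa [mul_assoc] using this) }
  have hopen : IsOpen ((K ⊔ M.toSubgroup : Subgroup G) : Set G) :=
    Subgroup.isOpen_mono le_sup_right M.isOpen'
  refine ⟨K ⊔ M.toSubgroup, le_sup_left, ⟨f, ?_⟩, hopen, fun k ↦ hr' _ _ (by simp)⟩
  have : DiscreteTopology (K ⧸ V.toSubgroup) := QuotientGroup.discreteTopology V.isOpen'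
  refine continuous_of_continuousAt_one f ?_
  rw [ContinuousAt, map_one, nhds_discrete (K ⧸ V.toSubgroup), Filter.tendsto_pure]
  filter_upwards [(M.isOpen'.preimage continuous_subtype_val).mem_nhds
    (show ((1 : (K ⊔ M.toSubgroup : Subgroup G)) : G) ∈ M.toSubgroup from M.toSubgroup.one_mem)]
    with u hu
  exact hr' u 1 (by simpa using hu)

theorem isRetractOf_of_bijective_comp_inclusion {G : Type*} [Group G] [TopologicalSpace G]
    [T1Space G] {K U : Subgroup G} (hU : IsClosed (U : Set G)) (hKU : K ≤ U) (g : U →ₜ* K)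
    (hg : Function.Bijective fun k ↦ g (Subgroup.inclusion hKU k)) : IsRetractOf K U := by
  have hmem (x : G) : x ∈ (g : U →* K).ker.map U.subtype ↔ ∃ hx : x ∈ U, g ⟨x, hx⟩ = 1 := by
    simp [MonoidHom.mem_ker]
  refine ⟨hKU, (g : U →* K).ker.map U.subtype, ?_, Subgroup.map_subtype_le _, ?_, ?_, ?_⟩
  · rw [Subgroup.coe_map]
    exact hU.isClosedEmbedding_subtypeVal.isClosedMap _
      (isClosed_singleton.preimage g.continuous_toFun)
  · rw [Subgroup.subgroupOf, Subgroup.comap_map_eq_self_of_injective U.subtype_injective]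
    infer_instance
  · ext x
    constructor
    · rintro ⟨k, hk, n, hn, rfl⟩
      exact U.mul_mem (hKU hk) ((hmem n).mp hn).1
    · intro hx
      obtain ⟨k, hk⟩ := hg.2 (g ⟨x, hx⟩)
      refine ⟨k, k.2, (k : G)⁻¹ * x, (hmem _).mpr ⟨U.mul_mem (U.inv_mem (hKU k.2)) hx, ?_⟩,
        mul_inv_cancel_left _ _⟩
      have : (⟨(k : G)⁻¹ * x, U.mul_mem (U.inv_mem (hKU k.2)) hx⟩ : U)
        = (Subgroup.inclusion hKU k)⁻¹ * ⟨x, hx⟩ := rfl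
      rw [this, map_mul, map_inv, ← hk]
      exact inv_mul_cancel _
  · rw [eq_bot_iff]
    rintro x ⟨hxK, hxN⟩
    obtain ⟨hxU, hx1⟩ := (hmem x).mp hxN
    have : (⟨x, hxK⟩ : K) = 1 := hg.1 (hx1.trans (map_one (g.comp
      ⟨Subgroup.inclusion hKU, continuous_inclusion hKU⟩)).symm)
    exact congrArg Subtype.val this

theorem mainTheorem10 {G : Type u} [Group G] [TopologicalSpace G] [IsTopologicalGroup G]
    [CompactSpace G] [TotallyDisconnectedSpace G] (hG : IsProjectiveProfinite G)
    (K : Subgroup G) (hK : IsClosed (K : Set G))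
    (hfg : IsTopologicallyFinitelyGenerated K)
    (hss : IsProsupersolvable K)
    (hprimes : {p : Nat.Primes | profiniteOrder K p ≠ 0}.Finite) :
    ∃ U : Subgroup G, IsOpen (U : Set G) ∧ IsRetractOf K U := by
  have : CompactSpace K := isCompact_iff_compactSpace.mp hK.isCompact
  obtain ⟨V, hV⟩ := hss.exists_openNormalSubgroup_frattini hfg hprimes
  obtain ⟨U, hKU, f, hU, hf⟩ := exists_continuousMonoidHom_extending K V
  have : DiscreteTopology (K ⧸ V.toSubgroup) := QuotientGroup.discreteTopology V.isOpen'
  obtain ⟨g, hg⟩ := hG.of_isOpen hU (ProfiniteGrp.of K) (ProfiniteGrp.of (K ⧸ V.toSubgroup))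
    ⟨QuotientGroup.mk' V.toSubgroup, QuotientGroup.continuous_mk⟩ f QuotientGroup.mk_surjective
  replace hg (u : U) : ((g u : K) : K ⧸ V.toSubgroup) = f u := DFunLike.congr_fun hg u
  let h : K →ₜ* K := ContinuousMonoidHom.comp g
    ⟨Subgroup.inclusion hKU, continuous_inclusion hKU⟩
  have hh (k : K) : ((h k : K) : K ⧸ V.toSubgroup) = k := (hg _).trans (hf k)
  -- The image of `h` is closed and, by `hh`, supplements `V`.
  have hrange : (h : K →* K).range = ⊤ := by
    refine hV _ ?_ (top_le_iff.mp fun k _ ↦ ?_)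
    · exact (isCompact_range h.continuous_toFun).isClosed
    · exact Subgroup.mem_sup_of_normal_right.mpr
        ⟨h k, ⟨k, rfl⟩, (h k)⁻¹ * k, QuotientGroup.eq.mp (hh k), mul_inv_cancel_left _ _⟩
  have hsurj : Function.Surjective h := MonoidHom.range_eq_top.mp hrange
  exact ⟨U, hU, isRetractOf_of_bijective_comp_inclusion (U.isClosed_of_isOpen hU) hKU g
    ⟨hfg.injective_of_surjective h hsurj, hsurj⟩⟩
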